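/- There are a constant $C$ and a single query program $P$ for a comparison-based word RAM with the following property. Let $\mathcal I$ be any family of $n$ closed intervals $[s_i,e_i]\subset\mathbb R$ ($s_i\le e_i$, $0\le i<n$), each with a real weight $w_i$. Then $\mathcal I$ can be stored in a static, read-only data structure of $O(n)$ space, namely at most $C(n+1)$ memory cells, each holding either a real number or an integer between $0$ and $C(n+1)$, such that for every $q\in\mathbb R$ and every integer $k\ge 1$, the program $P$, given $q$ and $k$ and access to this data structure, answers the top-$k$ stabbing query $(q,k)$ in $O(\log n+k)$ time, namely in at most $C(\log n+k)$ steps (with $\log 0:=0$ if $n=0$). Here $\mathcal I$'s $i$-th interval is stabbed by $q$ if $s_i\le q\le e_i$. Answering the query $(q,k)$ means reporting, one after another and in order of non-increasing weight, the indices of $k$ distinct intervals stabbed by $q$ (of all intervals stabbed by $q$ if there are fewer than $k$) such that no unreported interval stabbed by $q$ has larger weight than a reported one; ties may be broken arbitrarily. The machine has a fixed number of integer registers and real registers; initially one register of each kind contains $k$ and $q$ respectively, and the others contain $0$. In one step it can set an integer register to a constant, copy, add, subtract (truncated at $0$) or halve (rounding down) integer registers, load a memory cell whose address is in an integer register into a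 register, jump, branch on a comparison of two integer registers or of two real registers, report the content of an integer register, or halt. No arithmetic on real numbers is available, and no integer register ever holds a value exceeding $\max\{C(n+1),k\}$. -/

import Mathlib

/-! Weighted intervals, top-k stabbing reports, and a comparison-based word RAM that queries a
static memory image. -/

noncomputable section

namespace TopKStabbing

/-- A closed interval `[left, right]` on the real line together with a real weight. -/
structure WeightedInterval where
  left : ℝ
  right : ℝ
  weight : ℝ
  left_le_right : left ≤ right

/-- The interval is stabbed by the point `q`. -/
def WeightedInterval.StabbedBy (J : WeightedInterval) (q : ℝ) : Prop :=
  J.left ≤ q ∧ q ≤ J.right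

/-- `out` is a correct answer to the top-`k` stabbing query at `q`: it lists, without repetition
and in order of non-increasing weight, `k` intervals stabbed by `q` (all of them if there are fewer
than `k`), and no stabbed interval that is not listed is heavier than a listed one. Ties between
equal weights may be broken arbitrarily. -/
structure IsTopKReport {n : ℕ} (I : Fin n → WeightedInterval) (q : ℝ) (k : ℕ)
    (out : List (Fin n)) : Prop where
  nodup : out.Nodup
  stabbed : ∀ i ∈ out, (I i).StabbedBy q
  length_eq : out.length = min k (Set.ncard {i : Fin n | (I i).StabbedBy q})
  sorted : out.Pairwise (fun i j => (I j).weight ≤ (I i).weight)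
  heaviest : ∀ i ∈ out, ∀ j, (I j).StabbedBy q → j ∉ out → (I j).weight ≤ (I i).weight

/-- A static memory image: an array of integer cells and an array of real cells. -/
structure Memory where
  words : List ℕ
  reals : List ℝ

/-- The space taken by a memory image: its number of cells. -/
def Memory.size (M : Memory) : ℕ := M.words.length + M.reals.length

/-- The instructions of the machine, each of unit cost. Arguments `r a b` are numbers of integer
registers, `f g` numbers of real registers, and `l` is a position in the program. Real numbers can
only be loaded and compared. The memory image is read-only. -/
inductive Instr where
  | const (r c : ℕ)
  | move (r a : ℕ)
  | plus (r a b : ℕ)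
  | minus (r a b : ℕ)
  | half (r a : ℕ)
  | loadWord (r a : ℕ)
  | loadReal (f a : ℕ)
  | jump (l : ℕ)
  | jumpIfLT (a b l : ℕ)
  | jumpIfRealLT (f g l : ℕ)
  | report (a : ℕ)
  | halt

/-- A program is a finite list of instructions. It mentions, hence uses, only finitely many
registers. -/
abbrev Program := List Instr

/-- A machine configuration: program counter, integer registers, real registers, and the integers
reported so far, in the order in which they were reported. -/
structure State where
  pc : ℕ
  reg : ℕ → ℕ
  freg : ℕ → ℝ
  out : List ℕ

/-- Go to the next instruction. -/
def State.next (σ : State) : State := { σ with pc := σ.pc + 1 }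

/-- Go to instruction `l` if `c` holds, and to the next instruction otherwise. -/
def State.branch (σ : State) (c : Prop) [Decidable c] (l : ℕ) : State :=
  { σ with pc := if c then l else σ.pc + 1 }

/-- Write `v` into integer register `r` and go to the next instruction. The machine word holds the
integers `0, …, B` only; a larger value is a fault (`none`). -/
def State.setReg (B : ℕ) (σ : State) (r v : ℕ) : Option State :=
  if v ≤ B then some { σ.next with reg := Function.update σ.reg r v } else none

/-- Write `x` into real register `f` and go to the next instruction. -/
def State.setFReg (σ : State) (f : ℕ) (x : ℝ) : State :=
  { σ.next with freg := Function.update σ.freg f x }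

/-- Execute one instruction with words bounded by `B`. Reading outside the memory image is a
fault, and `halt` has no successor. Subtraction is truncated at `0`, halving rounds down. -/
def Instr.exec (M : Memory) (B : ℕ) (σ : State) : Instr → Option State
  | .const r c => σ.setReg B r c
  | .move r a => σ.setReg B r (σ.reg a)
  | .plus r a b => σ.setReg B r (σ.reg a + σ.reg b)
  | .minus r a b => σ.setReg B r (σ.reg a - σ.reg b)
  | .half r a => σ.setReg B r (σ.reg a / 2)
  | .loadWord r a => (M.words[σ.reg a]?).bind (fun v => σ.setReg B r v)
  | .loadReal f a => (M.reals[σ.reg a]?).map (fun x => σ.setFReg f x)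
  | .jump l => some { σ with pc := l }
  | .jumpIfLT a b l => some (σ.branch (σ.reg a < σ.reg b) l)
  | .jumpIfRealLT f g l => some (σ.branch (σ.freg f < σ.freg g) l)
  | .report a => some { σ.next with out := σ.out ++ [σ.reg a] }
  | .halt => none

/-- One step of the program `P`. -/
def step (P : Program) (M : Memory) (B : ℕ) (σ : State) : Option State :=
  (P[σ.pc]?).bind (fun c => c.exec M B σ)

/-- Exactly `t` steps of the program `P`; `none` if a fault occurs or the program ends earlier. -/
def steps (P : Program) (M : Memory) (B : ℕ) : ℕ → State → Option State
  | 0, σ => some σ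
  | t + 1, σ => (step P M B σ).bind (steps P M B t)

/-- The initial configuration for a query `(q, k)`: `q` is in real register `0`, `k` is in integer
register `0`, all other registers are `0`. -/
def initial (q : ℝ) (k : ℕ) : State where
  pc := 0
  reg := Function.update (fun _ => 0) 0 k
  freg := Function.update (fun _ => 0) 0 q
  out := []

/-- Started on the query `(q, k)` with memory image `M` and words bounded by `B`, the program `P`
reaches a `halt` instruction after `t` steps, without any fault, having reported `out`. -/
def Answers (P : Program) (M : Memory) (B : ℕ) (q : ℝ) (k t : ℕ) (out : List ℕ) : Prop :=
  ∃ σ : State, steps P M B t (initial q k) = some σ ∧ P[σ.pc]? = some Instr.halt ∧ σ.out = out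

end TopKStabbing

end

namespace TopKStabbing

/-! The set of stabbed intervals depends only on the position of `q` among the `2n` endpoints: on
one of them or in a gap between them. These positions are numbered by `version`, and an interval is
stabbed exactly for a contiguous range of versions (`version_le_version_iff`). It therefore suffices
to store, for each version, the list of its intervals by decreasing weight: binary search finds the
version, and a walk of `k` nodes reports the answer.

All these lists fit in linear space by sharing. Intervals are prepended from lightest to heaviest,
and the root pointer is kept as a step function of the version. A new interval alive on `[a, b]`
must link to every old root in that range. Since a node holds two successors and a threshold
version, one node serves two consecutive runs of the root function, so the number of runs in `[a,
b]` is about halved (`changes_merge`). Many new nodes thus mean many lost changes, and the potential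
"words plus four times changes" grows by at most 16 per interval (`exists_represents`). The machine
side is `search_runs`, `root_runs` and `walk_runs`. -/

/-- Taking the first `k` stabbed intervals of a list sorted by weight answers the query. -/
theorem isTopKReport_take_filter {n : ℕ} (I : Fin n → WeightedInterval) (q : ℝ) (k : ℕ)
    (l : List (Fin n)) (hl : l.Nodup) (hmem : ∀ i, i ∈ l)
    (hs : l.Pairwise fun i j => (I j).weight ≤ (I i).weight)
    (p : Fin n → Bool) (hp : ∀ i, p i = true ↔ (I i).StabbedBy q) :
    IsTopKReport I q k ((l.filter p).take k) where
  nodup := (hl.filter p).sublist (List.take_sublist _ _)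
  stabbed i hi := (hp i).1 (List.mem_filter.1 (List.mem_of_mem_take hi)).2
  length_eq := by
    have h : {i : Fin n | (I i).StabbedBy q} = ((l.filter p).toFinset : Set (Fin n)) := by
      ext i
      simp [hp, hmem]
    rw [h, Set.ncard_coe_finset, List.toFinset_card_of_nodup (hl.filter p), List.length_take]
  sorted := (hs.sublist List.filter_sublist).sublist (List.take_sublist _ _)
  heaviest i hi j hj hjt := by
    have h := hs.sublist (List.filter_sublist (p := p))
    rw [← List.take_append_drop k (l.filter p), List.pairwise_append] at h
    refine h.2.2 i hi j ?_
    have : j ∈ l.filter p := List.mem_filter.2 ⟨hmem j, (hp j).2 hj⟩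
    rw [← List.take_append_drop k (l.filter p), List.mem_append] at this
    exact this.resolve_left hjt

/-! ### Versions: positions relative to the endpoints -/

/-- In a sorted list the entries below `q` form an initial segment. -/
theorem getElem_lt_iff_lt_countP (D : List ℝ) (hD : D.Pairwise (· ≤ ·)) (q : ℝ) (m : ℕ)
    (hm : m < D.length) : D[m] < q ↔ m < D.countP (fun x => decide (x < q)) := by
  induction D generalizing m with
  | nil => simp at hm
  | cons x D ih =>
    rw [List.pairwise_cons] at hD
    by_cases hx : x < q
    · cases m with
      | zero => simp [hx]
      | succ m => simpa [hx] using ih hD.2 m (by simpa using hm)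
    · have h0 : ∀ y ∈ D, ¬ y < q := fun y hy h => hx ((hD.1 y hy).trans_lt h)
      have hc : D.countP (fun x => decide (x < q)) = 0 := by simpa [List.countP_eq_zero] using h0
      rw [List.countP_cons_of_neg (by simpa using hx), hc]
      have := List.getElem_mem hm
      rcases List.mem_cons.1 this with h | h
      · simp [h, hx]
      · simp [h0 _ h]

open Classical in
/-- The position of `q` relative to the entries of `D`: odd at an entry, even in a gap. -/
noncomputable def version (D : List ℝ) (q : ℝ) : ℕ :=
  2 * D.countP (fun x => decide (x < q)) + if q ∈ D then 1 else 0

theorem countP_lt_mono (D : List ℝ) {x y : ℝ} (h : x ≤ y) :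
    D.countP (fun z => decide (z < x)) ≤ D.countP (fun z => decide (z < y)) :=
  List.countP_mono_left fun z _ hz => by
    simp only [decide_eq_true_eq] at hz ⊢
    exact hz.trans_le h

theorem countP_lt_strictMono (D : List ℝ) {x y : ℝ} (h : x < y) (hx : x ∈ D) :
    D.countP (fun z => decide (z < x)) < D.countP (fun z => decide (z < y)) := by
  obtain ⟨s, t, rfl⟩ := List.append_of_mem hx
  have h1 := countP_lt_mono s h.le
  have h2 := countP_lt_mono t h.le
  simp only [List.countP_append, List.countP_cons, h, lt_irrefl, decide_true, decide_false,
    if_true]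
  simp
  omega

/-- If `x` is an entry, it is counted for `y` only, and this 2 outweighs the parity bit of `x`.
Otherwise `y` is an entry and its parity bit decides. Two points of one gap share a version, so one
of them must be an entry. -/
theorem version_lt_version (D : List ℝ) {x y : ℝ} (h : x < y) (hxy : x ∈ D ∨ y ∈ D) :
    version D x < version D y := by
  unfold version
  by_cases hx : x ∈ D
  · have := countP_lt_strictMono D h hx
    simp only [hx, if_true]
    omega
  · have hy := hxy.resolve_left hx
    have := countP_lt_mono D h.le
    simp only [hx, hy, if_true, if_false]
    omega

/-- This turns stabbing into integer comparisons, as interval ends are always entries. -/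
theorem version_le_version_iff (D : List ℝ) {x y : ℝ} (hxy : x ∈ D ∨ y ∈ D) :
    version D x ≤ version D y ↔ x ≤ y := by
  constructor
  · intro h
    by_contra! hlt
    exact absurd (version_lt_version D hlt hxy.symm) (by omega)
  · intro h
    rcases h.eq_or_lt with rfl | h
    · rfl
    · exact (version_lt_version D h hxy).le

theorem version_le (D : List ℝ) (q : ℝ) : version D q ≤ 2 * D.length + 1 := by
  have := List.countP_le_length (l := D) (p := fun x => decide (x < q))
  unfold version
  split_ifs <;> omega

/-- `q` is an entry of a sorted list iff the first entry not below `q` does not exceed `q`. -/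
theorem mem_iff_getElem_countP (D : List ℝ) (hD : D.Pairwise (· ≤ ·)) (q : ℝ) (u : ℕ)
    (hu : u = D.countP (fun x => decide (x < q))) (hlt : u < D.length) :
    q ∈ D ↔ ¬ q < D[u] := by
  constructor
  · intro h
    obtain ⟨m, hm, rfl⟩ := List.getElem_of_mem h
    have h1 := (getElem_lt_iff_lt_countP D hD D[m] m hm).not.1 (lt_irrefl _)
    rw [not_lt]
    rcases (show u ≤ m by omega).eq_or_lt with h | h
    · simp [h]
    · exact List.pairwise_iff_getElem.1 hD _ _ _ _ h
  · intro h
    have h1 := (getElem_lt_iff_lt_countP D hD q u hlt).not.2 (by omega)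
    have : q = D[u] := le_antisymm (not_lt.1 h1) (not_lt.1 h)
    rw [this]
    exact List.getElem_mem hlt

theorem not_mem_of_length_le_countP (D : List ℝ) (q : ℝ)
    (h : D.length ≤ D.countP (fun x => decide (x < q))) : q ∉ D := by
  intro hq
  have := List.countP_eq_length.1 (le_antisymm List.countP_le_length h) q hq
  simp at this

/-! ### Shared linked lists and their amortised size -/

/-- At version `v` the pointer `P` into the memory words `x :: y :: ws` leads to the linked list
`l`. A node occupies four words: its entry, a threshold, and the successor pointers for versions
below the threshold and for the other versions. The pointer `0` is the empty list. -/
def Represents (ws : List ℕ) (v : ℕ) : ℕ → List ℕ → Prop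
  | P, [] => P = 0
  | P, i :: l => ∃ p m n₁ n₂, P = p + 2 ∧ ws[p]? = some i ∧ ws[p + 1]? = some m ∧
      ws[p + 2]? = some n₁ ∧ ws[p + 3]? = some n₂ ∧ Represents ws v (if v < m then n₁ else n₂) l

/-- Nodes are never modified, so older lists survive the addition of new ones. -/
theorem Represents.append {ws : List ℕ} {v P : ℕ} {l : List ℕ} (h : Represents ws v P l)
    (ws' : List ℕ) : Represents (ws ++ ws') v P l := by
  have key : ∀ {p x : ℕ}, ws[p]? = some x → (ws ++ ws')[p]? = some x := by
    intro p x hx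
    have := (List.getElem?_eq_some_iff.1 hx).1
    rw [List.getElem?_append_left this, hx]
  induction l generalizing P with
  | nil => exact h
  | cons i l ih =>
    obtain ⟨p, m, n₁, n₂, hP, h0, h1, h2, h3, hr⟩ := h
    exact ⟨p, m, n₁, n₂, hP, key h0, key h1, key h2, key h3, ih hr⟩

/-- The number of changes of value of `f` below `v`. -/
noncomputable abbrev changes (f : ℕ → ℕ) (v : ℕ) : ℕ :=
  Nat.count (fun u => f u ≠ f (u + 1)) v

/-- `changes f v` is the index of the run of `f` containing `v`; the index determines the value. -/
theorem eq_of_changes_eq (f : ℕ → ℕ) {v w : ℕ} (h : changes f v = changes f w) : f v = f w := by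
  wlog hvw : v ≤ w generalizing v w
  · exact (this h.symm (by omega)).symm
  induction w, hvw using Nat.le_induction with
  | base => rfl
  | succ w hvw ih =>
    have h1 := Nat.count_monotone (fun u => f u ≠ f (u + 1)) hvw
    have h2 := Nat.count_succ (fun u => f u ≠ f (u + 1)) w
    simp only [changes] at *
    split_ifs at h2 with h3
    · omega
    · rw [ih (by omega)]
      simpa using h3

/-- Merging the runs of a function on `[a, b]` in pairs halves the number of its changes there. -/
theorem changes_merge (f : ℕ → ℕ) (a b s V : ℕ) (hab : a ≤ b) (hbV : b ≤ V) :
    changes (fun v => if a ≤ v ∧ v ≤ b then s + 4 * (changes f v / 2 - changes f a / 2) else f v) V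
        + changes f b ≤
      changes f V + changes f a + 2 + (changes f b / 2 - changes f a / 2) := by
  set g : ℕ → ℕ := fun v =>
    if a ≤ v ∧ v ≤ b then s + 4 * (changes f v / 2 - changes f a / 2) else f v with hg
  have mono : Monotone (changes f) := Nat.count_monotone _
  have fs : ∀ v, changes f (v + 1) = changes f v + if f v ≠ f (v + 1) then 1 else 0 :=
    Nat.count_succ _
  have gs : ∀ v, changes g (v + 1) = changes g v + if g v ≠ g (v + 1) then 1 else 0 :=
    Nat.count_succ _
  -- `g` follows `f` outside `[a, b]`, costs at most one extra change on entry and one on exit, and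
  -- inside changes only when the halved run index does.
  have h1 : ∀ v, v < a → changes g v ≤ changes f v := by
    intro v
    induction v with
    | zero => intro _; simp [changes]
    | succ v ih =>
      intro hv
      have e1 : g v = f v := by simp only [hg]; rw [if_neg]; omega
      have e2 : g (v + 1) = f (v + 1) := by simp only [hg]; rw [if_neg]; omega
      rw [gs, fs, e1, e2]
      have := ih (by omega)
      omega
  have h2 : changes g a ≤ changes f a + 1 := by
    cases a with
    | zero => simp [changes]
    | succ a =>
      have := h1 a (by omega)
      have := mono (Nat.le_succ a)
      have := gs a
      split_ifs at this <;> simp only [Nat.succ_eq_add_one] at * <;> omega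
  have h3 : ∀ v, a ≤ v → v ≤ b →
      changes g v ≤ changes f a + 1 + (changes f v / 2 - changes f a / 2) := by
    intro v hav
    induction v, hav using Nat.le_induction with
    | base => intro _; omega
    | succ v hav ih =>
      intro hv
      have := ih (by omega)
      have e1 : g v = s + 4 * (changes f v / 2 - changes f a / 2) := by
        simp only [hg]; rw [if_pos]; omega
      have e2 : g (v + 1) = s + 4 * (changes f (v + 1) / 2 - changes f a / 2) := by
        simp only [hg]; rw [if_pos]; omega
      have m1 := mono hav
      have g1 := gs v
      have f1 := fs v
      rw [e1, e2] at g1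
      split_ifs at g1 f1 <;> omega
  have h4 : ∀ v, b < v → changes g v + changes f b ≤
      changes f v + changes f a + 2 + (changes f b / 2 - changes f a / 2) := by
    intro v hbv
    induction v, Nat.succ_le_of_lt hbv using Nat.le_induction with
    | base =>
      have := h3 b hab le_rfl
      have := mono (Nat.le_succ b)
      have := gs b
      split_ifs at this <;> simp only [Nat.succ_eq_add_one] at * <;> omega
    | succ v hv ih =>
      have := ih (by omega)
      have e1 : g v = f v := by simp only [hg]; rw [if_neg]; omega
      have e2 : g (v + 1) = f (v + 1) := by simp only [hg]; rw [if_neg]; omega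
      rw [gs, fs, e1, e2]
      omega
  rcases hbV.eq_or_lt with rfl | hlt
  · have := h3 b hab le_rfl
    omega
  · exact h4 V hlt

/-- Linear-size linked structure: for every version `v`, a pointer to the list of those members of
`l` that are alive at `v`, in the order of `l`. -/
theorem exists_represents {ι : Type*} (label a b : ι → ℕ) (V : ℕ) (l : List ι)
    (hl : ∀ i ∈ l, label i ≤ V ∧ a i ≤ b i ∧ b i ≤ V) :
    ∃ (ws : List ℕ) (root : ℕ → ℕ),
      ws.length + 4 * changes root V ≤ 16 * l.length ∧
      (∀ w ∈ ws, w ≤ V + ws.length + 1) ∧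
      (∀ v, root v ≤ ws.length + 1) ∧
      ∀ v, Represents ws v (root v)
        ((l.filter fun i => decide (a i ≤ v ∧ v ≤ b i)).map label) := by
  induction l with
  | nil =>
    refine ⟨[], fun _ => 0, ?_, by simp, by simp, by simp [Represents]⟩
    have : changes (fun _ => 0) V = 0 := by
      induction V with
      | zero => simp [changes]
      | succ V ih => simp [changes, Nat.count_succ]
    simp [this]
  | cons i l ih =>
    obtain ⟨ws, root, hlen, hws, hroot, hrep⟩ := ih fun j hj => hl j (List.mem_cons_of_mem _ hj)
    obtain ⟨hi, hab, hbV⟩ := hl i List.mem_cons_self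
    set c := changes root with hc
    have mono : Monotone c := Nat.count_monotone _
    -- `g x` is the root pointer on run `x`.
    obtain ⟨g, hg, hgle⟩ : ∃ g : ℕ → ℕ, (∀ v, g (c v) = root v) ∧ ∀ x, g x ≤ ws.length + 1 := by
      classical
      refine ⟨fun x => if h : ∃ v, c v = x then root h.choose else 0, fun v => ?_, fun x => ?_⟩
      · have h : ∃ w, c w = c v := ⟨v, rfl⟩
        simp only [h, dif_pos]
        exact eq_of_changes_eq root h.choose_spec
      · dsimp only
        split_ifs
        · exact hroot _
        · omega
    -- `mid x` is the first version whose run index is at least `x`, cut off at `b i + 1` so that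
    -- thresholds stay small.
    obtain ⟨mid, hmid, hmidle⟩ : ∃ mid : ℕ → ℕ, (∀ x v, v ≤ b i → (v < mid x ↔ c v < x)) ∧
        ∀ x, mid x ≤ b i + 1 := by
      have hex : ∀ x, ∃ v, v = b i + 1 ∨ x ≤ c v := fun x => ⟨_, Or.inl rfl⟩
      refine ⟨fun x => Nat.find (hex x), fun x v hv => ?_, fun x => Nat.find_min' _ (Or.inl rfl)⟩
      rw [Nat.lt_find_iff]
      constructor
      · intro h
        have := h v le_rfl
        omega
      · intro h w hw
        have := mono hw
        omega
    -- Word `t` of the new block: node `t / 4` serves the runs `2j` and `2j + 1`, where `j = t / 4 +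
    -- c (a i) / 2`. Pairing by parity of the global index may leave half-used nodes at both ends.
    set F : ℕ → ℕ := fun t =>
      if t % 4 = 0 then label i
      else if t % 4 = 1 then mid (2 * (t / 4 + c (a i) / 2) + 1)
      else if t % 4 = 2 then g (2 * (t / 4 + c (a i) / 2))
      else g (2 * (t / 4 + c (a i) / 2) + 1) with hF
    set m := c (b i) / 2 - c (a i) / 2 + 1 with hm
    refine ⟨ws ++ (List.range (4 * m)).map F, fun v => if a i ≤ v ∧ v ≤ b i then
      ws.length + 2 + 4 * (c v / 2 - c (a i) / 2) else root v, ?_, ?_, ?_, ?_⟩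
    · have h1 : changes (fun v => if a i ≤ v ∧ v ≤ b i then
          ws.length + 2 + 4 * (c v / 2 - c (a i) / 2) else root v) V + c (b i) ≤
          c V + c (a i) + 2 + (c (b i) / 2 - c (a i) / 2) :=
        changes_merge root (a i) (b i) (ws.length + 2) V hab hbV
      -- Let `Δ = c (b i) - c (a i)` and let `d` be the difference of the halves. There are `4 * (d
      -- + 1)` new words, and the changes grow by at most `2 + d - Δ`. As `2 * d ≤ Δ + 1`, the
      -- potential grows by at most `12 + 8 * d - 4 * Δ ≤ 16`.
      have h2 := mono hab
      have h3 := mono hbV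
      simp only [List.length_append, List.length_map, List.length_range, List.length_cons]
      omega
    · intro w hw
      simp only [List.length_append, List.length_map, List.length_range]
      rcases List.mem_append.1 hw with hw | hw
      · have := hws w hw
        omega
      · obtain ⟨t, -, rfl⟩ := List.mem_map.1 hw
        have h1 := hmidle (2 * (t / 4 + c (a i) / 2) + 1)
        have h2 := hgle (2 * (t / 4 + c (a i) / 2))
        have h3 := hgle (2 * (t / 4 + c (a i) / 2) + 1)
        simp only [hF]
        split_ifs <;> omega
    · intro v
      simp only [List.length_append, List.length_map, List.length_range]
      split_ifs with hv
      · have := mono hv.2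
        omega
      · have := hroot v
        omega
    · intro v
      dsimp only
      by_cases hv : a i ≤ v ∧ v ≤ b i
      · rw [if_pos hv, List.filter_cons_of_pos (by simpa using hv), List.map_cons]
        have m1 := mono hv.1
        have m2 := mono hv.2
        have get : ∀ t, t < 4 →
            (ws ++ (List.range (4 * m)).map F)[ws.length + 4 * (c v / 2 - c (a i) / 2) + t]? =
              some (F (4 * (c v / 2 - c (a i) / 2) + t)) := by
          intro t ht
          rw [List.getElem?_append_right (by omega), List.getElem?_map, List.getElem?_range (by omega)]
          simp only [Option.map_some, Option.some.injEq]
          congr 1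
          omega
        refine ⟨_, _, _, _, by omega, (get 0 (by omega)).trans ?_, get 1 (by omega),
          get 2 (by omega), get 3 (by omega), ?_⟩
        · simp only [hF]
          rw [if_pos (by omega)]
        · have e : ∀ t, t < 4 → (4 * (c v / 2 - c (a i) / 2) + t) / 4 + c (a i) / 2 = c v / 2 := by
            intro t ht
            omega
          have d : ∀ t, t < 4 → (4 * (c v / 2 - c (a i) / 2) + t) % 4 = t := by
            intro t ht
            omega
          have f1 : F (4 * (c v / 2 - c (a i) / 2) + 1) = mid (2 * (c v / 2) + 1) := by
            simp [hF, e 1, d 1]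
          have f2 : F (4 * (c v / 2 - c (a i) / 2) + 2) = g (2 * (c v / 2)) := by
            simp [hF, e 2, d 2]
          have f3 : F (4 * (c v / 2 - c (a i) / 2) + 3) = g (2 * (c v / 2) + 1) := by
            simp [hF, e 3, d 3]
          -- `v` lies below the threshold iff its run index is even, so the test selects the run of
          -- `v` itself.
          have hnext : (if v < F (4 * (c v / 2 - c (a i) / 2) + 1)
              then F (4 * (c v / 2 - c (a i) / 2) + 2)
              else F (4 * (c v / 2 - c (a i) / 2) + 3)) = root v := by
            rw [f1, f2, f3, ← hg v]
            simp only [hmid _ v hv.2]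
            split_ifs <;> congr 1 <;> omega
          rw [hnext]
          exact (hrep v).append _
      · rw [if_neg hv, List.filter_cons_of_neg (by simpa using hv)]
        exact (hrep v).append _


/-! ### The query program -/

/-- Binary search for the position of `q`, followed by a walk along the linked list of the version
found. -/
def queryProgram : Program := [
  -- Integer registers: 0 counts down `k`, 1 and 2 delimit the search, 3 is midpoint or pointer, 4
  -- is the version, 5 and 6 hold 1 and 0. Word 0 stores the number of endpoints, word 1 the address
  -- of the root table.
  .loadWord 2 6, .const 5 1,
  .jumpIfLT 1 2 4, .jump 12,
  .plus 3 1 2, .half 3 3, .loadReal 1 3, .jumpIfRealLT 1 0 10,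
  .move 2 3, .jump 2,
  .plus 1 3 5, .jump 2,
  .loadWord 2 6, .plus 4 1 1, .jumpIfLT 1 2 16, .jump 19,
  .loadReal 1 1, .jumpIfRealLT 0 1 19, .plus 4 4 5,
  .loadWord 3 5, .plus 3 3 4, .loadWord 3 3,
  .jumpIfLT 6 3 24, .halt,
  .jumpIfLT 6 0 26, .halt,
  .loadWord 1 3, .report 1, .minus 0 0 5, .plus 3 3 5, .loadWord 1 3, .plus 3 3 5,
  .jumpIfLT 4 1 34, .plus 3 3 5, .loadWord 3 3, .jump 22]

/-! ### Time-bounded execution, with one rule per instruction -/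

theorem steps_add (P : Program) (M : Memory) (B s t : ℕ) (σ : State) :
    steps P M B (s + t) σ = (steps P M B s σ).bind (steps P M B t) := by
  induction s generalizing σ with
  | zero => simp [steps]
  | succ s ih =>
    rw [Nat.succ_add]
    simp only [steps]
    cases step P M B σ with
    | none => rfl
    | some τ => simp [ih]

/-- Within `t` steps from `σ` the program reaches, without a fault, a state satisfying `Q`. -/
def Runs (P : Program) (M : Memory) (B t : ℕ) (σ : State) (Q : State → Prop) : Prop :=
  ∃ s ≤ t, ∃ τ, steps P M B s σ = some τ ∧ Q τ

namespace Runs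

variable {P : Program} {M : Memory} {B s t pc r a b c l f g v : ℕ} {x : ℝ} {σ τ : State}
  {reg : ℕ → ℕ} {freg : ℕ → ℝ} {out : List ℕ} {Q R : State → Prop}

theorem done (h : Q σ) : Runs P M B t σ Q := ⟨0, Nat.zero_le _, σ, rfl, h⟩

theorem trans (h : Runs P M B s σ Q) (h' : ∀ τ, Q τ → Runs P M B t τ R) :
    Runs P M B (s + t) σ R := by
  obtain ⟨s', hs, τ, h1, h2⟩ := h
  obtain ⟨t', ht, υ, h3, h4⟩ := h' τ h2
  exact ⟨s' + t', by omega, υ, by rw [steps_add, h1, Option.bind_some, h3], h4⟩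

theorem mono (hst : s ≤ t) (h : Runs P M B s σ Q) : Runs P M B t σ Q := by
  obtain ⟨s', hs, h⟩ := h
  exact ⟨s', by omega, h⟩

theorem cons (h : step P M B σ = some τ) (h' : Runs P M B t τ Q) : Runs P M B (t + 1) σ Q := by
  obtain ⟨s, hs, υ, h1, h2⟩ := h'
  exact ⟨s + 1, by omega, υ, by rw [steps, h, Option.bind_some, h1], h2⟩

theorem const (hP : P[pc]? = some (.const r v)) (hB : v ≤ B)
    (h : Runs P M B t ⟨pc + 1, Function.update reg r v, freg, out⟩ Q) :
    Runs P M B (t + 1) ⟨pc, reg, freg, out⟩ Q :=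
  cons (by simp [step, hP, Instr.exec, State.setReg, State.next, hB]) h

theorem move (v : ℕ) (hP : P[pc]? = some (.move r a)) (hv : reg a = v) (hB : v ≤ B)
    (h : Runs P M B t ⟨pc + 1, Function.update reg r v, freg, out⟩ Q) :
    Runs P M B (t + 1) ⟨pc, reg, freg, out⟩ Q :=
  cons (by simp [step, hP, Instr.exec, State.setReg, State.next, hB, hv]) h

theorem plus (v : ℕ) (hP : P[pc]? = some (.plus r a b)) (hv : reg a + reg b = v) (hB : v ≤ B)
    (h : Runs P M B t ⟨pc + 1, Function.update reg r v, freg, out⟩ Q) :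
    Runs P M B (t + 1) ⟨pc, reg, freg, out⟩ Q :=
  cons (by simp [step, hP, Instr.exec, State.setReg, State.next, hB, hv]) h

theorem minus (v : ℕ) (hP : P[pc]? = some (.minus r a b)) (hv : reg a - reg b = v) (hB : v ≤ B)
    (h : Runs P M B t ⟨pc + 1, Function.update reg r v, freg, out⟩ Q) :
    Runs P M B (t + 1) ⟨pc, reg, freg, out⟩ Q :=
  cons (by simp only [step, hP, Option.bind_some, Instr.exec, State.setReg, State.next, hv, hB,
    if_true]) h

theorem half (v : ℕ) (hP : P[pc]? = some (.half r a)) (hv : reg a / 2 = v) (hB : v ≤ B)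
    (h : Runs P M B t ⟨pc + 1, Function.update reg r v, freg, out⟩ Q) :
    Runs P M B (t + 1) ⟨pc, reg, freg, out⟩ Q :=
  cons (by simp [step, hP, Instr.exec, State.setReg, State.next, hB, hv]) h

theorem loadWord (a' v : ℕ) (hP : P[pc]? = some (.loadWord r a)) (ha : reg a = a')
    (hv : M.words[a']? = some v) (hB : v ≤ B)
    (h : Runs P M B t ⟨pc + 1, Function.update reg r v, freg, out⟩ Q) :
    Runs P M B (t + 1) ⟨pc, reg, freg, out⟩ Q :=
  cons (by simp [step, hP, Instr.exec, State.setReg, State.next, hB, ha, hv]) h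

theorem loadReal (a' : ℕ) (x : ℝ) (hP : P[pc]? = some (.loadReal f a)) (ha : reg a = a')
    (hx : M.reals[a']? = some x)
    (h : Runs P M B t ⟨pc + 1, reg, Function.update freg f x, out⟩ Q) :
    Runs P M B (t + 1) ⟨pc, reg, freg, out⟩ Q :=
  cons (by simp [step, hP, Instr.exec, State.setFReg, State.next, ha, hx]) h

theorem jump (hP : P[pc]? = some (.jump l)) (h : Runs P M B t ⟨l, reg, freg, out⟩ Q) :
    Runs P M B (t + 1) ⟨pc, reg, freg, out⟩ Q :=
  cons (by simp [step, hP, Instr.exec]) h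

theorem jumpIfLT_pos (hP : P[pc]? = some (.jumpIfLT a b l)) (hlt : reg a < reg b)
    (h : Runs P M B t ⟨l, reg, freg, out⟩ Q) : Runs P M B (t + 1) ⟨pc, reg, freg, out⟩ Q :=
  cons (by simp [step, hP, Instr.exec, State.branch, hlt]) h

theorem jumpIfLT_neg (hP : P[pc]? = some (.jumpIfLT a b l)) (hlt : ¬ reg a < reg b)
    (h : Runs P M B t ⟨pc + 1, reg, freg, out⟩ Q) : Runs P M B (t + 1) ⟨pc, reg, freg, out⟩ Q :=
  cons (by simp only [step, hP, Option.bind_some, Instr.exec, State.branch, hlt, if_false]) h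

theorem jumpIfRealLT_pos (hP : P[pc]? = some (.jumpIfRealLT f g l)) (hlt : freg f < freg g)
    (h : Runs P M B t ⟨l, reg, freg, out⟩ Q) : Runs P M B (t + 1) ⟨pc, reg, freg, out⟩ Q :=
  cons (by simp [step, hP, Instr.exec, State.branch, hlt]) h

theorem jumpIfRealLT_neg (hP : P[pc]? = some (.jumpIfRealLT f g l)) (hlt : ¬ freg f < freg g)
    (h : Runs P M B t ⟨pc + 1, reg, freg, out⟩ Q) : Runs P M B (t + 1) ⟨pc, reg, freg, out⟩ Q :=
  cons (by simp only [step, hP, Option.bind_some, Instr.exec, State.branch, hlt, if_false]) h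

theorem report (v : ℕ) (hP : P[pc]? = some (.report a)) (hv : reg a = v)
    (h : Runs P M B t ⟨pc + 1, reg, freg, out ++ [v]⟩ Q) :
    Runs P M B (t + 1) ⟨pc, reg, freg, out⟩ Q :=
  cons (by simp [step, hP, Instr.exec, State.next, hv]) h

end Runs

/-! ### Correctness and cost of the three phases -/

/-- The walk along a represented list reports its first `k` entries. -/
theorem walk_runs (x y : ℕ) (ws tbl : List ℕ) (rs : List ℝ) (B v : ℕ)
    (hB : ∀ w ∈ ws, w ≤ B) (hlen : ws.length + 2 ≤ B) (l : List ℕ) (P k : ℕ)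
    (hk : k ≤ B) (hP : P ≤ B) (hrep : Represents ws v P l) (reg : ℕ → ℕ) (freg : ℕ → ℝ)
    (out : List ℕ) (h0 : reg 0 = k) (h3 : reg 3 = P) (h4 : reg 4 = v) (h5 : reg 5 = 1)
    (h6 : reg 6 = 0) :
    Runs queryProgram ⟨x :: y :: (ws ++ tbl), rs⟩ B (12 * k + 2) ⟨22, reg, freg, out⟩
      fun σ => queryProgram[σ.pc]? = some Instr.halt ∧ σ.out = out ++ l.take k := by
  induction l generalizing P k reg out with
  | nil =>
    have : P = 0 := hrep
    exact .jumpIfLT_neg rfl (by omega) (.done ⟨rfl, by simp⟩)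
  | cons i l ih =>
    obtain ⟨p, m, n₁, n₂, rfl, g0, g1, g2, g3, hr⟩ := hrep
    rcases Nat.eq_zero_or_pos k with rfl | hkpos
    · exact .jumpIfLT_pos rfl (by omega) <| .jumpIfLT_neg rfl (by omega) <|
        .done ⟨rfl, by simp⟩
    obtain ⟨k, rfl⟩ := Nat.exists_eq_succ_of_ne_zero hkpos.ne'
    have lt3 := (List.getElem?_eq_some_iff.1 g3).1
    have bnd : ∀ {p w : ℕ}, ws[p]? = some w → w ≤ B := fun h => hB _ (List.mem_of_getElem? h)
    have app : ∀ {p w : ℕ}, ws[p]? = some w → (x :: y :: (ws ++ tbl))[p + 2]? = some w := by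
      intro p w h
      rw [List.getElem?_cons_succ, List.getElem?_cons_succ,
        List.getElem?_append_left (List.getElem?_eq_some_iff.1 h).1, h]
    -- Both outcomes of the threshold test end in this common tail.
    have rest : ∀ (n : ℕ) (p' : ℕ) (reg : ℕ → ℕ), ws[p']? = some n →
        n = (if v < m then n₁ else n₂) → reg 0 = k → reg 3 = p' + 2 → reg 4 = v → reg 5 = 1 →
        reg 6 = 0 → Runs queryProgram ⟨x :: y :: (ws ++ tbl), rs⟩ B (12 * k + 4)
          ⟨34, reg, freg, out ++ [i]⟩
          fun σ => queryProgram[σ.pc]? = some Instr.halt ∧ σ.out = out ++ (i :: l).take (k + 1) := by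
      intro n p' reg hn hn' r0 r3 r4 r5 r6
      refine .loadWord (p' + 2) n rfl r3 (app hn) (bnd hn) <| .jump rfl ?_
      have := ih n k (by omega) (bnd hn) (hn' ▸ hr) (Function.update reg 3 n) (out ++ [i])
        (by simp [r0]) (by simp) (by simp [r4]) (by simp [r5]) (by simp [r6])
      simpa using this
    -- A round takes at most 12 instructions, two of them in `rest`; the final 2 pays for the exit
    -- tests.
    rw [show 12 * (k + 1) + 2 = 12 * k + 4 + 1 + 1 + 1 + 1 + 1 + 1 + 1 + 1 + 1 + 1 by omega]
    refine .jumpIfLT_pos rfl (by omega) <| .jumpIfLT_pos rfl (by omega) <|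
      .loadWord (p + 2) i rfl h3 (app g0) (bnd g0) <| .report i rfl (by simp) <|
      .minus k rfl (by simp [h0, h5]) (by omega) <|
      .plus (p + 3) rfl (by simp [h3, h5]) (by omega) <|
      .loadWord (p + 3) m rfl (by simp) (app g1) (bnd g1) <|
      .plus (p + 4) rfl (by simp [h5]) (by omega) ?_
    by_cases hv : v < m
    · refine .jumpIfLT_pos rfl (by simpa [h4] using hv) <| .mono (Nat.le_succ _) ?_
      apply rest n₁ (p + 2) _ g2 (by rw [if_pos hv]) <;> simp [h4, h5, h6]
    · refine .jumpIfLT_neg rfl (by simpa [h4] using hv) <|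
        .plus (p + 5) rfl (by simp [h5]) (by omega) ?_
      apply rest n₂ (p + 3) _ g3 (by rw [if_neg hv]) <;> simp [h4, h5, h6]

/-- Binary search for the border `u` of the entries below `q`. -/
theorem search_runs (words : List ℕ) (D : List ℝ) (B u : ℕ) (q : ℝ) (k : ℕ)
    (hB : 2 * D.length + 2 ≤ B) (hu : ∀ m (hm : m < D.length), D[m] < q ↔ m < u)
    (e : ℕ) (lo hi : ℕ) (hlo : lo ≤ u) (hhi : u ≤ hi) (hD : hi ≤ D.length) (he : hi - lo < 2 ^ e)
    (reg : ℕ → ℕ) (freg : ℕ → ℝ) (h0 : reg 0 = k) (h1 : reg 1 = lo) (h2 : reg 2 = hi)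
    (h5 : reg 5 = 1) (h6 : reg 6 = 0) (f0 : freg 0 = q) :
    Runs queryProgram ⟨words, D⟩ B (7 * e + 2) ⟨2, reg, freg, []⟩ fun σ =>
      ∃ reg' freg', σ = ⟨12, reg', freg', []⟩ ∧
        reg' 0 = k ∧ reg' 1 = u ∧ reg' 5 = 1 ∧ reg' 6 = 0 ∧ freg' 0 = q := by
  induction e generalizing lo hi reg freg with
  | zero =>
    have : ¬ lo < hi := by simp at he; omega
    exact .jumpIfLT_neg rfl (by omega) <| .jump rfl <|
      .done ⟨reg, freg, rfl, h0, by omega, h5, h6, f0⟩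
  | succ e ih =>
    by_cases hlt : lo < hi
    · have hm : (lo + hi) / 2 < D.length := by omega
      rw [pow_succ] at he
      -- Either branch of a round takes 7 instructions and halves the range; leaving the loop takes
      -- 2.
      rw [show 7 * (e + 1) + 2 = 7 * e + 2 + 1 + 1 + 1 + 1 + 1 + 1 + 1 by omega]
      refine .jumpIfLT_pos rfl (by omega) <| .plus (lo + hi) rfl (by omega) (by omega) <|
        .half ((lo + hi) / 2) rfl (by simp) (by omega) <|
        .loadReal ((lo + hi) / 2) D[(lo + hi) / 2] rfl (by simp) (List.getElem?_eq_getElem hm) ?_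
      by_cases hq : D[(lo + hi) / 2] < q
      · have hmu := (hu _ hm).1 hq
        refine .jumpIfRealLT_pos rfl (by simpa [f0] using hq) <|
          .plus ((lo + hi) / 2 + 1) rfl (by simp [h5]) (by omega) <| .jump rfl ?_
        apply ih ((lo + hi) / 2 + 1) hi hmu hhi hD (by omega) <;> simp [h0, h2, h5, h6, f0]
      · have hmu := (hu _ hm).not.1 hq
        refine .jumpIfRealLT_neg rfl (by simpa [f0] using hq) <|
          .move ((lo + hi) / 2) rfl (by simp) (by omega) <| .jump rfl ?_
        apply ih lo ((lo + hi) / 2) hlo (by omega) (by omega) (by omega) <;>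
          simp [h0, h1, h5, h6, f0]
    · exact .mono (by omega) <| .jumpIfLT_neg (t := 1) rfl (by omega) <| .jump rfl <|
        .done ⟨reg, freg, rfl, h0, by omega, h5, h6, f0⟩

/-- From the position of `q` in the sorted list `D` the program finds the version of `q` and the
root pointer stored for it. -/
theorem root_runs (ws tbl : List ℕ) (D : List ℝ) (hD : D.Pairwise (· ≤ ·)) (B : ℕ) (q : ℝ)
    (k P : ℕ) (hB : 2 * D.length + ws.length + 3 ≤ B) (hB' : ws.length + 2 + version D q ≤ B)
    (hP : P ≤ B) (hroot : tbl[version D q]? = some P) (reg : ℕ → ℕ) (freg : ℕ → ℝ)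
    (h0 : reg 0 = k) (h1 : reg 1 = D.countP (fun x => decide (x < q))) (h5 : reg 5 = 1)
    (h6 : reg 6 = 0) (f0 : freg 0 = q) :
    Runs queryProgram ⟨D.length :: (ws.length + 2) :: (ws ++ tbl), D⟩ B 9 ⟨12, reg, freg, []⟩
      fun σ => ∃ reg' freg', σ = ⟨22, reg', freg', []⟩ ∧
        reg' 0 = k ∧ reg' 3 = P ∧ reg' 4 = version D q ∧ reg' 5 = 1 ∧ reg' 6 = 0 := by
  obtain ⟨u, hu⟩ : ∃ u, u = D.countP (fun x => decide (x < q)) := ⟨_, rfl⟩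
  have hule : u ≤ D.length := hu ▸ List.countP_le_length
  have hget : (D.length :: (ws.length + 2) :: (ws ++ tbl))[ws.length + version D q + 2]? =
      some P := by
    rw [List.getElem?_cons_succ, List.getElem?_cons_succ, List.getElem?_append_right (by omega),
      ← hroot]
    congr 1
    omega
  have table : ∀ (reg : ℕ → ℕ) (freg : ℕ → ℝ), reg 0 = k → reg 4 = version D q → reg 5 = 1 →
      reg 6 = 0 →
      Runs queryProgram ⟨D.length :: (ws.length + 2) :: (ws ++ tbl), D⟩ B 3 ⟨19, reg, freg, []⟩
        fun σ => ∃ reg' freg', σ = ⟨22, reg', freg', []⟩ ∧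
          reg' 0 = k ∧ reg' 3 = P ∧ reg' 4 = version D q ∧ reg' 5 = 1 ∧ reg' 6 = 0 := by
    intro reg freg r0 r4 r5 r6
    refine .loadWord 1 (ws.length + 2) rfl r5 rfl (by omega) <|
      .plus (ws.length + version D q + 2) rfl (by simp [r4]; omega) (by omega) <|
      .loadWord (ws.length + version D q + 2) P rfl (by simp) hget hP <|
      .done ⟨_, _, rfl, ?_⟩
    simp [r0, r4, r5, r6]
  rw [← hu] at h1
  -- The version is `u + u`, plus one if `q` equals entry `u`. Since `D[u]` is not below `q`, the
  -- single test `q < D[u]` decides; for `u = D.length` there is no entry to load.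
  refine .loadWord 0 D.length rfl h6 rfl (by omega) <|
    .plus (u + u) rfl (by simp [h1]) (by omega) ?_
  by_cases hlt : u < D.length
  · have hmem := mem_iff_getElem_countP D hD q u hu hlt
    refine .jumpIfLT_pos rfl (by simpa [h1] using hlt) <|
      .loadReal u D[u] rfl (by simp [h1]) (List.getElem?_eq_getElem hlt) ?_
    by_cases hq : q < D[u]
    · have hver : version D q = u + u := by
        rw [version, if_neg (by simpa [hmem] using hq), ← hu]
        omega
      refine .jumpIfRealLT_pos rfl (by simpa [f0] using hq) <| .mono (Nat.le_succ _) ?_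
      apply table <;> simp [h0, h5, h6, hver]
    · have hver : version D q = u + u + 1 := by
        rw [version, if_pos (hmem.2 hq), ← hu]
        omega
      refine .jumpIfRealLT_neg rfl (by simpa [f0] using hq) <|
        .plus (u + u + 1) rfl (by simp [h5]) (by omega) ?_
      apply table <;> simp [h0, h5, h6, hver]
  · have hver : version D q = u + u := by
      rw [version, if_neg (not_mem_of_length_le_countP D q (by omega)), ← hu]
      omega
    refine .jumpIfLT_neg rfl (by simpa [h1] using hlt) <| .jump rfl <|
      .mono (show 3 ≤ 5 by omega) ?_
    apply table <;> simp [h0, h5, h6, hver]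

/-- The complete run of the query program. -/
theorem answers_queryProgram (ws tbl : List ℕ) (D : List ℝ) (hD : D.Pairwise (· ≤ ·)) (B : ℕ)
    (q : ℝ) (k P : ℕ) (l : List ℕ) (hk : k ≤ B) (hw : ∀ w ∈ ws, w ≤ B)
    (hB : 2 * D.length + ws.length + 3 ≤ B) (hB' : ws.length + 2 + version D q ≤ B)
    (hP : P ≤ B) (hroot : tbl[version D q]? = some P)
    (hrep : Represents ws (version D q) P l) :
    ∃ t ≤ 7 * Nat.log 2 D.length + 12 * k + 22,
      Answers queryProgram ⟨D.length :: (ws.length + 2) :: (ws ++ tbl), D⟩ B q k t (l.take k) := by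
  have search := search_runs (D.length :: (ws.length + 2) :: (ws ++ tbl)) D B
    (D.countP (fun x => decide (x < q))) q k (by omega) (getElem_lt_iff_lt_countP D hD q)
    (Nat.log 2 D.length + 1) 0 D.length (by omega) List.countP_le_length le_rfl
    (by simpa using Nat.lt_pow_succ_log_self (by omega) D.length)
  have run : Runs queryProgram ⟨D.length :: (ws.length + 2) :: (ws ++ tbl), D⟩ B
      (7 * (Nat.log 2 D.length + 1) + 2 + (9 + (12 * k + 2)) + 1 + 1) (initial q k)
      fun σ => queryProgram[σ.pc]? = some Instr.halt ∧ σ.out = l.take k := by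
    refine .loadWord 0 D.length rfl (by simp) rfl (by omega) <| .const rfl (by omega) ?_
    refine (search _ _ ?_ ?_ ?_ ?_ ?_ ?_).trans ?_
    iterate 6 simp
    rintro _ ⟨reg₁, freg₁, rfl, a0, a1, a5, a6, f0⟩
    refine (root_runs ws tbl D hD B q k P hB hB' hP hroot reg₁ freg₁ a0 a1 a5 a6 f0).trans ?_
    rintro _ ⟨reg₂, freg₂, rfl, b0, b3, b4, b5, b6⟩
    exact walk_runs D.length (ws.length + 2) ws tbl D B (version D q) hw (by omega) l P k hk hP
      hrep reg₂ freg₂ [] b0 b3 b4 b5 b6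
  obtain ⟨t, ht, σ, hσ, hhalt, hout⟩ := run
  exact ⟨t, by omega, σ, hσ, hhalt, hout⟩

end TopKStabbing

/-! ### Assembling the data structure -/

open TopKStabbing in
theorem mainTheorem1 :
    ∃ (P : TopKStabbing.Program) (C : ℕ),
      ∀ (n : ℕ) (I : Fin n → TopKStabbing.WeightedInterval),
        ∃ M : TopKStabbing.Memory,
          M.size ≤ C * (n + 1) ∧
          (∀ v ∈ M.words, v ≤ C * (n + 1)) ∧
          ∀ (q : ℝ) (k : ℕ), 0 < k →
            ∃ (t : ℕ) (out : List (Fin n)),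
              TopKStabbing.Answers P M (max (C * (n + 1)) k) q k t
                (out.map Fin.val) ∧
              (t : ℝ) ≤ C * (Real.log n + k) ∧
              TopKStabbing.IsTopKReport I q k out := by
  -- 100 is generous: there are at most `22 * n + 4` cells, and the time is at most `14 * log n + 41
  -- * k`.
  refine ⟨queryProgram, 100, fun n I => ?_⟩
  set D : List ℝ := (List.ofFn (fun i => (I i).left) ++ List.ofFn (fun i => (I i).right)).insertionSort
    (· ≤ ·) with hDdef
  have hD : D.Pairwise (· ≤ ·) := List.pairwise_insertionSort _ _
  have hDlen : D.length = 2 * n := by simp [hDdef]; omega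
  have hmem : ∀ x, x ∈ D ↔ (∃ i, (I i).left = x) ∨ ∃ i, (I i).right = x := by
    intro x
    simp [hDdef, List.mem_ofFn]
  have hleft : ∀ i, (I i).left ∈ D := fun i => (hmem _).2 (Or.inl ⟨i, rfl⟩)
  have hright : ∀ i, (I i).right ∈ D := fun i => (hmem _).2 (Or.inr ⟨i, rfl⟩)
  set l : List (Fin n) := (List.finRange n).insertionSort fun i j => (I j).weight ≤ (I i).weight
    with hldef
  have hperm : l.Perm (List.finRange n) := List.perm_insertionSort _ _
  have hsort : l.Pairwise fun i j => (I j).weight ≤ (I i).weight := by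
    have : Std.Total fun i j : Fin n => (I j).weight ≤ (I i).weight := ⟨fun i j => le_total _ _⟩
    have : IsTrans (Fin n) fun i j : Fin n => (I j).weight ≤ (I i).weight :=
      ⟨fun i j k h h' => h'.trans h⟩
    exact List.pairwise_insertionSort _ _
  have hver : ∀ q, version D q ≤ 4 * n + 1 := fun q => by
    have := version_le D q
    omega
  obtain ⟨ws, root, hlen, hws, hroot, hrep⟩ := exists_represents (fun i : Fin n => i.val)
    (fun i => version D (I i).left) (fun i => version D (I i).right) (4 * n + 1) l fun i _ =>
      ⟨by omega, (version_le_version_iff D (Or.inl (hleft i))).2 (I i).left_le_right, hver _⟩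
  have hllen : l.length = n := by rw [hperm.length_eq, List.length_finRange]
  refine ⟨⟨D.length :: (ws.length + 2) :: (ws ++ (List.range (4 * n + 2)).map root), D⟩, ?_, ?_, ?_⟩
  · simp only [Memory.size, List.length_cons, List.length_append, List.length_map,
      List.length_range]
    omega
  · intro v hv
    simp only [List.mem_cons, List.mem_append, List.mem_map] at hv
    rcases hv with rfl | rfl | hv | ⟨u, -, rfl⟩
    · omega
    · omega
    · have := hws v hv
      omega
    · have := hroot u
      omega
  · intro q k hk
    have hB := le_max_left (100 * (n + 1)) k
    have hq := hver q
    obtain ⟨t, ht, hans⟩ := answers_queryProgram ws ((List.range (4 * n + 2)).map root) D hD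
      (max (100 * (n + 1)) k) q k (root (version D q)) _ (le_max_right _ _)
      (fun w hw => by have := hws w hw; omega) (by omega) (by omega)
      (by have := hroot (version D q); omega)
      (by rw [List.getElem?_map, List.getElem?_range (by omega), Option.map_some])
      (hrep (version D q))
    rw [← List.map_take] at hans
    refine ⟨t, _, hans, ?_, isTopKReport_take_filter I q k l
      (hperm.nodup_iff.2 (List.nodup_finRange n))
      (fun i => hperm.mem_iff.2 (List.mem_finRange i)) hsort _ fun i => ?_⟩
    -- Additive constants are absorbed by `k ≥ 1`.
    · have hk' : (1 : ℝ) ≤ k := by exact_mod_cast hk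
      have ht' : (t : ℝ) ≤ 7 * (Nat.log 2 D.length : ℕ) + 12 * k + 22 := by exact_mod_cast ht
      -- The factor 2 comes from `log 2 > 1/2`, the summand 1 from the two endpoints per interval.
      have hlog : ((Nat.log 2 D.length : ℕ) : ℝ) ≤ 2 * Real.log n + 1 := by
        rcases Nat.eq_zero_or_pos n with rfl | hn
        · simp [hDlen]
        have hn0 : (n : ℝ) ≠ 0 := by positivity
        have h1 : (2 : ℝ) ^ Nat.log 2 n ≤ n := by exact_mod_cast Nat.pow_log_le_self 2 hn.ne'
        have h2 := Real.log_le_log (by positivity) h1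
        rw [Real.log_pow] at h2
        have h3 : Nat.log 2 D.length = Nat.log 2 n + 1 := by
          rw [hDlen, mul_comm, Nat.log_mul_base (by omega) hn.ne']
        rw [h3]
        push_cast
        nlinarith [Real.log_two_gt_d9, (Nat.cast_nonneg (Nat.log 2 n) : (0 : ℝ) ≤ _)]
      have hnn : 0 ≤ Real.log n := Real.log_natCast_nonneg n
      push_cast
      linarith
    · rw [decide_eq_true_iff, version_le_version_iff D (Or.inl (hleft i)),
        version_le_version_iff D (Or.inr (hright i))]
      rfl
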